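/- Let $n \ge 3$ be an integer. For a real number $w \ge 1$ let $A(w)$ be the adjacency matrix of the path with vertices $1, 2, \dots, n$ (all edges of weight $1$) with a loop of weight $w$ added at each of the two end vertices; that is, $A(w)$ is the real symmetric $n \times n$ matrix with $A(w)_{j,j+1} = A(w)_{j+1,j} = 1$ for $1 \le j \le n-1$, $A(w)_{1,1} = A(w)_{n,n} = w$, and all other entries $0$. Put $U_w(t) = \exp(i t A(w))$ for $t \in \mathbb{R}$. There is pretty good state transfer between the end vertices, from vertex $1$ to vertex $n$, if for every $\epsilon > 0$ there is a time $t \in \mathbb{R}$ with $|U_w(t)_{1,n}| > 1 - \epsilon$. Then the set of all $w \in [1,\infty)$ for which there is no pretty good state transfer from vertex $1$ to vertex $n$ is a dense subset of $[1,\infty)$. -/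

import Mathlib

/-- The adjacency matrix of the path on the `n` vertices `0, 1, …, n - 1`, in which consecutive
vertices are joined by an edge of weight `1`, with a loop of weight `w` at each of the two end
vertices `0` and `n - 1`. -/
noncomputable def loopedPathMatrix (n : ℕ) (w : ℝ) : Matrix (Fin n) (Fin n) ℝ :=
  Matrix.of fun i j =>
    if i = j then
      if i.val = 0 ∨ i.val + 1 = n then w else 0
    else
      if i.val + 1 = j.val ∨ j.val + 1 = i.val then 1 else 0

/-- The transition matrix `U(t) = exp(i t H)` of the continuous-time quantum walk with
(real symmetric) Hamiltonian `H`. -/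
noncomputable def transitionMatrix {V : Type*} [Fintype V] [DecidableEq V]
    (H : Matrix V V ℝ) (t : ℝ) : Matrix V V ℂ :=
  NormedSpace.exp ((Complex.I * (t : ℂ)) • H.map (fun x : ℝ => (x : ℂ)))

/-- Pretty good state transfer from `a` to `b`: for every `ε > 0` there is a time `t` with
`|U(t)_{a,b}| > 1 - ε`. -/
def HasPGST {V : Type*} [Fintype V] [DecidableEq V] (H : Matrix V V ℝ) (a b : V) : Prop :=
  ∀ ε : ℝ, 0 < ε → ∃ t : ℝ, 1 - ε < ‖transitionMatrix H t a b‖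

/-!
The path has simple spectrum, and each of its eigenvectors is even or odd under reflection. Hence
the entry of `exp (i t A(w))` between the two ends is `∑ l, m l * s l * exp (i t θ l)`, with weights
`m l > 0` of sum `1` and signs `s l = ±1`; both signs occur, since the sum vanishes at `t = 0`.
For its modulus to approach `1`, all the numbers `s l * exp (i t θ l)` must approach a common phase.

Let `i` and `j` have signs `1` and `-1`, and let `k` be arbitrary. If
`(θ k - θ i) / (θ j - θ i) = p / q` with `p` odd and `q` even, such a common phase is impossible:
with `z l = exp (i t θ l)`, the relation `(z j / z i) ^ p = (z k / z i) ^ q` would read `-1 = 1`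
in the limit (`StrictEigensystem.not_hasPGST`).

The sorted eigenvalues depend continuously on `w` and their signs do not depend on `w`
(`loopedPathMatrix.continuous_val`, `loopedPathMatrix.mirrorSign_eq`). The fractions `p / q` as above are dense, so if pretty good
state transfer took place for all `w` in some interval, the ratios `(θ k - θ i) / (θ j - θ i)` would
be constant there (`loopedPathMatrix.ratio_const_of_hasPGST`), that is, `θ k = θ i + r k * g` with
constants `r k`. Then the second and third central moments of the spectrum are `c₂ * g ^ 2` and
`c₃ * g ^ 3` with constants `c₂`, `c₃`, so `c₃ ^ 2` times the cube of the second equals `c₂ ^ 3`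
times the square of the third. The traces of the first three powers of `A(w)` give both moments as
polynomials in `w`, so this is a polynomial identity. At `w = 0` the third moment vanishes and the
second does not, so `c₃ = 0` and the third moment vanishes identically, which is not the case
(`not_central_moments_proportional`).
-/

/-! ### Matrices with simple spectrum -/

/-- An orthogonal diagonalisation of a real matrix with strictly increasing eigenvalues: the `l`-th
column of `vec` is a unit eigenvector for the eigenvalue `val l`. -/
structure StrictEigensystem {n : ℕ} (A : Matrix (Fin n) (Fin n) ℝ) where
  val : Fin n → ℝ
  vec : Matrix (Fin n) (Fin n) ℝ
  strictMono_val : StrictMono val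
  vec_mul_transpose : vec * vec.transpose = 1
  mul_vec : A * vec = vec * Matrix.diagonal val

namespace StrictEigensystem

variable {n : ℕ} {A B : Matrix (Fin n) (Fin n) ℝ}

theorem transpose_mul_vec (E : StrictEigensystem A) : E.vec.transpose * E.vec = 1 :=
  mul_eq_one_comm.mp E.vec_mul_transpose

theorem mulVec_col (E : StrictEigensystem A) (l : Fin n) :
    A.mulVec (fun a => E.vec a l) = E.val l • (fun a => E.vec a l) := by
  funext a
  have := congrFun (congrFun E.mul_vec a) l
  rw [Matrix.mul_diagonal, Matrix.mul_apply] at this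
  simpa [Matrix.mulVec, dotProduct, mul_comm] using this

theorem sum_row_mul_row (E : StrictEigensystem A) (a b : Fin n) :
    ∑ l, E.vec a l * E.vec b l = if a = b then 1 else 0 := by
  have := congrFun (congrFun E.vec_mul_transpose a) b
  simpa [Matrix.mul_apply, Matrix.one_apply] using this

theorem sum_col_mul_col (E : StrictEigensystem A) (l m : Fin n) :
    ∑ a, E.vec a l * E.vec a m = if l = m then 1 else 0 := by
  have := congrFun (congrFun E.transpose_mul_vec l) m
  simpa [Matrix.mul_apply, Matrix.one_apply] using this

theorem eq_mul_diagonal_mul (E : StrictEigensystem A) :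
    A = E.vec * Matrix.diagonal E.val * E.vec.transpose := by
  rw [← E.mul_vec, Matrix.mul_assoc, E.vec_mul_transpose, Matrix.mul_one]

theorem pow_eq (E : StrictEigensystem A) (k : ℕ) :
    A ^ k = E.vec * Matrix.diagonal (fun l => E.val l ^ k) * E.vec.transpose := by
  induction k with
  | zero => simp [E.vec_mul_transpose]
  | succ k ih =>
    have h : Matrix.diagonal (fun l => E.val l ^ (k + 1))
        = Matrix.diagonal E.val * Matrix.diagonal (fun l => E.val l ^ k) := by
      rw [Matrix.diagonal_mul_diagonal]
      simp [pow_succ']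
    rw [pow_succ', ih, h, ← Matrix.mul_assoc, ← Matrix.mul_assoc, E.mul_vec,
      Matrix.mul_assoc E.vec]

theorem trace_pow (E : StrictEigensystem A) (k : ℕ) : (A ^ k).trace = ∑ l, E.val l ^ k := by
  rw [E.pow_eq, Matrix.mul_assoc, Matrix.trace_mul_comm, Matrix.mul_assoc, E.transpose_mul_vec,
    Matrix.mul_one, Matrix.trace_diagonal]

/-- The spectral expansion of an entry of the transition matrix. -/
theorem transitionMatrix_apply (E : StrictEigensystem A) (t : ℝ) (a b : Fin n) :
    transitionMatrix A t a b =
      ∑ l, (E.vec a l * E.vec b l : ℝ) * Complex.exp ((t * E.val l : ℝ) * Complex.I) := by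
  set Q : Matrix (Fin n) (Fin n) ℂ := E.vec.map (fun x : ℝ => (x : ℂ)) with hQ
  set R : Matrix (Fin n) (Fin n) ℂ := E.vec.transpose.map (fun x : ℝ => (x : ℂ)) with hR
  have hmap (M N : Matrix (Fin n) (Fin n) ℝ) : (M * N).map (fun x : ℝ => (x : ℂ))
      = M.map (fun x : ℝ => (x : ℂ)) * N.map (fun x : ℝ => (x : ℂ)) :=
    Matrix.map_mul (f := Complex.ofRealHom)
  have hQR : Q * R = 1 := by
    rw [hQ, hR, ← hmap, E.vec_mul_transpose]
    exact Matrix.map_one _ Complex.ofReal_zero Complex.ofReal_one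
  have hinv : Q⁻¹ = R := Matrix.inv_eq_right_inv hQR
  have hunit : IsUnit Q := (Matrix.isUnit_iff_isUnit_det _).mpr
    (Matrix.isUnit_det_of_right_inverse hQR)
  have hA : (Complex.I * (t : ℂ)) • A.map (fun x : ℝ => (x : ℂ))
      = Q * Matrix.diagonal (fun l => ((t * E.val l : ℝ) : ℂ) * Complex.I) * Q⁻¹ := by
    rw [hinv]
    conv_lhs => rw [E.eq_mul_diagonal_mul, hmap, hmap]
    rw [← hQ, ← hR, ← Matrix.smul_mul, ← Matrix.mul_smul]
    congr 2
    rw [Matrix.diagonal_map Complex.ofReal_zero, ← Matrix.diagonal_smul]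
    congr 1
    funext l
    simp
    ring
  rw [transitionMatrix, hA, Matrix.exp_conj _ _ hunit, Matrix.exp_diagonal, hinv,
    Matrix.mul_apply]
  refine Finset.sum_congr rfl fun l _ => ?_
  rw [Matrix.mul_diagonal]
  simp [hQ, hR, Pi.coe_exp, Complex.exp_eq_exp_ℂ]
  ring

/-- If two matrices are within `δ` of each other in operator norm, then every eigenvalue of the
first has within distance `δ` an eigenvalue of the second whose eigenvector is not orthogonal to
the given one. -/
theorem exists_val_near (E : StrictEigensystem A) (F : StrictEigensystem B) {δ : ℝ} (hδ : 0 ≤ δ)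
    (hAB : ∀ v : Fin n → ℝ, ∑ a, ((B - A).mulVec v a) ^ 2 ≤ δ ^ 2 * ∑ a, v a ^ 2) (l : Fin n) :
    ∃ m, |F.val m - E.val l| ≤ δ ∧ ∑ a, E.vec a l * F.vec a m ≠ 0 := by
  set v : Fin n → ℝ := fun a => E.vec a l with hv
  set c : Fin n → ℝ := fun m => ∑ a, v a * F.vec a m with hc
  have parseval (u : Fin n → ℝ) : ∑ m, (∑ a, u a * F.vec a m) ^ 2 = ∑ a, u a ^ 2 := by
    have h1 : (fun m => ∑ a, u a * F.vec a m) = Matrix.vecMul u F.vec := rfl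
    have h2 := Matrix.dotProduct_mulVec (Matrix.vecMul u F.vec) F.vec.transpose u
    rw [Matrix.vecMul_vecMul, F.vec_mul_transpose, Matrix.vecMul_one, Matrix.mulVec_transpose] at h2
    simpa [dotProduct, Matrix.vecMul, pow_two] using h2
  have hBt : B.transpose = B := by
    rw [F.eq_mul_diagonal_mul]
    simp [Matrix.transpose_mul, Matrix.mul_assoc]
  have hcoef (m : Fin n) :
      ∑ a, ((B - A).mulVec v a) * F.vec a m = (F.val m - E.val l) * c m := by
    have h1 : B.mulVec v ⬝ᵥ (fun a => F.vec a m) = F.val m * c m := by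
      rw [← Matrix.vecMul_transpose, hBt, ← Matrix.dotProduct_mulVec, F.mulVec_col]
      simp only [dotProduct, hc, Pi.smul_apply, smul_eq_mul, Finset.mul_sum]
      exact Finset.sum_congr rfl fun a _ => by ring
    have h2 : A.mulVec v ⬝ᵥ (fun a => F.vec a m) = E.val l * c m := by
      rw [E.mulVec_col, smul_dotProduct]
      rfl
    change (B - A).mulVec v ⬝ᵥ (fun a => F.vec a m) = _
    rw [Matrix.sub_mulVec, sub_dotProduct, h1, h2]
    ring
  have hone : ∑ m, c m ^ 2 = 1 := by
    rw [parseval, ← (show _ = (1 : ℝ) by simpa using E.sum_col_mul_col l l)]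
    simp [hv, pow_two]
  have hres : ∑ m, ((F.val m - E.val l) * c m) ^ 2 ≤ ∑ m, δ ^ 2 * c m ^ 2 := by
    rw [← Finset.mul_sum, parseval]
    calc _ = ∑ m, (∑ a, ((B - A).mulVec v a) * F.vec a m) ^ 2 := by simp only [hcoef]
      _ = _ := parseval _
      _ ≤ _ := hAB v
  by_contra! hcon
  have hle (m : Fin n) : δ ^ 2 * c m ^ 2 ≤ ((F.val m - E.val l) * c m) ^ 2 := by
    by_cases hm : |F.val m - E.val l| ≤ δ
    · have : c m = 0 := hcon m hm
      simp [this]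
    · rw [mul_pow]
      refine mul_le_mul_of_nonneg_right ?_ (sq_nonneg _)
      rw [← sq_abs (F.val m - E.val l)]
      exact pow_le_pow_left₀ hδ (not_le.mp hm).le 2
  have hex : ∃ m, c m ≠ 0 := by
    by_contra! h
    simp [h] at hone
  obtain ⟨m, hm⟩ := hex
  have hm' : δ < |F.val m - E.val l| := by
    by_contra! h
    exact hm (hcon m h)
  refine absurd hres (not_le.mpr (Finset.sum_lt_sum (fun m _ => hle m) ⟨m, Finset.mem_univ _, ?_⟩))
  rw [mul_pow, ← sq_abs (F.val m - E.val l)]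
  exact mul_lt_mul_of_pos_right (pow_lt_pow_left₀ hm' hδ two_ne_zero) (by positivity)

/-- Eigenvalues and eigenvectors move continuously: if the gaps of the first spectrum exceed `2δ`,
the eigenvalue found by `exists_val_near` has the same position in the order. -/
theorem val_near (E : StrictEigensystem A) (F : StrictEigensystem B) {δ : ℝ} (hδ : 0 ≤ δ)
    (hAB : ∀ v : Fin n → ℝ, ∑ a, ((B - A).mulVec v a) ^ 2 ≤ δ ^ 2 * ∑ a, v a ^ 2)
    (hgap : ∀ l m, l < m → E.val l + 2 * δ < E.val m) (l : Fin n) :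
    |F.val l - E.val l| ≤ δ ∧ ∑ a, E.vec a l * F.vec a l ≠ 0 := by
  choose f hf hf' using fun l => E.exists_val_near F hδ hAB l
  have hmono : StrictMono f := by
    intro l m hlm
    rw [← F.strictMono_val.lt_iff_lt]
    have h1 := abs_le.mp (hf l)
    have h2 := abs_le.mp (hf m)
    linarith [hgap l m hlm]
  have hid : f l = l := by
    have hle : l ≤ f l := hmono.le_apply
    have hge : f l ≤ l := hmono.apply_le
    exact le_antisymm hge hle
  have h1 := hf l
  have h2 := hf' l
  rw [hid] at h1 h2
  exact ⟨h1, h2⟩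

end StrictEigensystem

/-- A real symmetric matrix whose eigenvectors are determined by one coordinate has simple spectrum,
so its eigenvalues can be listed in strictly increasing order. -/
theorem Matrix.IsHermitian.nonempty_strictEigensystem {n : ℕ} {A : Matrix (Fin n) (Fin n) ℝ}
    (hA : A.IsHermitian) (a : Fin n)
    (h : ∀ (v : Fin n → ℝ) (θ : ℝ), A.mulVec v = θ • v → v a = 0 → v = 0) :
    Nonempty (StrictEigensystem A) := by
  set U : Matrix (Fin n) (Fin n) ℝ := hA.eigenvectorUnitary.1 with hU
  have hUU : U * U.transpose = 1 := by
    have := Matrix.mem_unitaryGroup_iff.mp hA.eigenvectorUnitary.2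
    simpa [Matrix.star_eq_conjTranspose] using this
  have hUU' : U.transpose * U = 1 := mul_eq_one_comm.mp hUU
  have hcol (l : Fin n) : A.mulVec (fun b => U b l) = hA.eigenvalues l • (fun b => U b l) := by
    have heq : (fun b => U b l) = (hA.eigenvectorBasis l).ofLp := hA.eigenvectorUnitary_col_eq l
    rw [heq]
    exact hA.mulVec_eigenvectorBasis l
  have horth (l m : Fin n) : ∑ b, U b l * U b m = if l = m then 1 else 0 := by
    have := congrFun (congrFun hUU' l) m
    simpa [Matrix.mul_apply, Matrix.one_apply] using this
  have hinj : Function.Injective hA.eigenvalues := by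
    intro l m hlm
    by_contra hne
    -- This combination of the two eigenvectors vanishes at `a`.
    have hz := h (U a m • (fun b => U b l) - U a l • (fun b => U b m)) (hA.eigenvalues l) (by
      rw [Matrix.mulVec_sub, Matrix.mulVec_smul, Matrix.mulVec_smul, hcol, hcol, ← hlm, smul_sub,
        smul_comm, smul_comm (U a l)]) (by simp; ring)
    have h1 : U a m = 0 := by
      have : ∑ b, (U a m • (fun b => U b l) - U a l • (fun b => U b m)) b * U b l = 0 := by
        rw [hz]; simp
      simpa [sub_mul, Finset.sum_sub_distrib, mul_assoc, ← Finset.mul_sum, horth, hne,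
        Ne.symm hne] using this
    have h2 := h (fun b => U b m) _ (hcol m) h1
    have h3 := horth m m
    simp only [if_true] at h3
    rw [Finset.sum_eq_zero (fun b _ => by simp [congrFun h2 b])] at h3
    exact zero_ne_one h3
  set s := Tuple.sort hA.eigenvalues
  refine ⟨⟨hA.eigenvalues ∘ s, U.submatrix id s, ?_, ?_, ?_⟩⟩
  · exact (Tuple.monotone_sort _).strictMono_of_injective (hinj.comp s.injective)
  · rw [Matrix.transpose_submatrix, Matrix.submatrix_mul_equiv, hUU]
    simp
  · ext b l
    rw [Matrix.mul_diagonal]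
    have := congrFun (hcol (s l)) b
    simpa [Matrix.mul_apply, Matrix.mulVec, dotProduct, mul_comm] using this

/-! ### Obstruction to pretty good state transfer -/

/-- Equality in the triangle inequality for a convex combination of unit complex numbers. -/
theorem eq_sum_of_one_le_norm_sum {ι : Type*} [Fintype ι] {m : ι → ℝ} {u : ι → ℂ}
    (hm : ∀ l, 0 < m l) (hsum : ∑ l, m l = 1) (hu : ∀ l, ‖u l‖ = 1)
    (h : 1 ≤ ‖∑ l, (m l : ℂ) * u l‖) (l : ι) : u l = ∑ k, (m k : ℂ) * u k := by
  set S : ℂ := ∑ k, (m k : ℂ) * u k with hS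
  have hre : S.re = ∑ k, m k * (u k).re := by simp [hS]
  have him : S.im = ∑ k, m k * (u k).im := by simp [hS]
  have hnorm (z : ℂ) : ‖z‖ ^ 2 = z.re ^ 2 + z.im ^ 2 := by
    rw [← Complex.normSq_eq_norm_sq, Complex.normSq_apply]; ring
  have hS1 : 1 ≤ S.re ^ 2 + S.im ^ 2 := by
    rw [← hnorm]; nlinarith
  -- The weighted variance of the `u k` is `1 - ‖S‖ ^ 2`.
  have hvar : ∑ k, m k * ‖u k - S‖ ^ 2 = 1 - (S.re ^ 2 + S.im ^ 2) := by
    have hterm (k : ι) : m k * ‖u k - S‖ ^ 2 = m k * (1 + (S.re ^ 2 + S.im ^ 2))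
        - 2 * S.re * (m k * (u k).re) - 2 * S.im * (m k * (u k).im) := by
      have h1 := hnorm (u k)
      rw [hu k] at h1
      rw [hnorm, Complex.sub_re, Complex.sub_im]
      linear_combination (-m k) * h1
    simp only [hterm, Finset.sum_sub_distrib, ← Finset.sum_mul, ← Finset.mul_sum, hsum, ← hre,
      ← him]
    ring
  have hzero : ∑ k, m k * ‖u k - S‖ ^ 2 = 0 :=
    le_antisymm (by linarith) (Finset.sum_nonneg fun k _ => by have := hm k; positivity)
  have hl := (Finset.sum_eq_zero_iff_of_nonneg
    (fun k _ => by have := hm k; positivity)).mp hzero l (Finset.mem_univ l)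
  have : ‖u l - S‖ ^ 2 = 0 := (mul_eq_zero.mp hl).resolve_left (hm l).ne'
  exact sub_eq_zero.mp (norm_eq_zero.mp (pow_eq_zero_iff two_ne_zero |>.mp this))

/-- A rational relation between eigenvalue gaps that rules out pretty good state transfer: if the
signs `vec b l / vec a l` are `1` for `i` and `-1` for `j`, then in a limit of state transfers the
phases at `i` and `j` would be opposite and those at `i` and `k` equal or opposite, which an odd
multiple `p` and an even multiple `q` do not allow. -/
theorem StrictEigensystem.not_hasPGST {n : ℕ} {A : Matrix (Fin n) (Fin n) ℝ}
    (E : StrictEigensystem A) {a b : Fin n} (h0 : ∀ l, E.vec a l ≠ 0)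
    (hsq : ∀ l, (E.vec b l / E.vec a l) ^ 2 = 1) {i j : Fin n} (k : Fin n)
    (hi : E.vec b i / E.vec a i = 1) (hj : E.vec b j / E.vec a j = -1) {p q : ℤ}
    (hp : Odd p) (hq : Even q)
    (hpq : (p : ℝ) * (E.val j - E.val i) = q * (E.val k - E.val i)) : ¬ HasPGST A a b := by
  intro hP
  set r : Fin n → ℝ := fun l => E.vec b l / E.vec a l with hr
  have hr1 (l : Fin n) : r l = 1 ∨ r l = -1 :=
    sq_eq_sq_iff_eq_or_eq_neg.mp ((hsq l).trans (one_pow 2).symm)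
  let F : (Fin n → Circle) → ℝ := fun z =>
    ‖∑ l, ((E.vec a l ^ 2 : ℝ) : ℂ) * ((r l : ℂ) * (z l : ℂ))‖
  -- The closed subset of the torus that contains all the phases `exp (i t θ l)`.
  let K : Set (Fin n → Circle) := {z | (z j / z i) ^ p = (z k / z i) ^ q}
  have hF : Continuous F := by fun_prop
  have hK : IsCompact K := by
    refine IsClosed.isCompact (isClosed_eq ?_ ?_)
    · exact ((continuous_apply j).div' (continuous_apply i)).zpow p
    · exact ((continuous_apply k).div' (continuous_apply i)).zpow q
  let z : ℝ → Fin n → Circle := fun t l => Circle.exp (t * E.val l)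
  have hzK (t : ℝ) : z t ∈ K := by
    change (Circle.exp _ / Circle.exp _) ^ p = (Circle.exp _ / Circle.exp _) ^ q
    rw [← Circle.exp_sub, ← Circle.exp_sub, ← Circle.exp_zsmul, ← Circle.exp_zsmul]
    congr 1
    simp only [zsmul_eq_mul]
    linear_combination t * hpq
  have hzF (t : ℝ) : ‖transitionMatrix A t a b‖ = F (z t) := by
    rw [E.transitionMatrix_apply]
    congr 1
    refine Finset.sum_congr rfl fun l _ => ?_
    have : E.vec a l * E.vec b l = E.vec a l ^ 2 * r l := by
      have := h0 l
      simp only [hr]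
      field_simp
    rw [this, Circle.coe_exp]
    push_cast
    ring
  obtain ⟨x, hxK, hx⟩ := hK.exists_isMaxOn ⟨z 0, hzK 0⟩ hF.continuousOn
  have hx1 : 1 ≤ F x := by
    by_contra! hlt
    obtain ⟨t, ht⟩ := hP (1 - F x) (by linarith)
    rw [hzF] at ht
    have : F (z t) ≤ F x := hx (hzK t)
    linarith
  have hall := eq_sum_of_one_le_norm_sum (m := fun l => E.vec a l ^ 2)
    (u := fun l => (r l : ℂ) * (x l : ℂ)) (fun l => by have := h0 l; positivity)
    (by simpa [pow_two] using E.sum_row_mul_row a a)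
    (fun l => by rcases hr1 l with h | h <;> simpa [h] using Circle.norm_coe (x l)) hx1
  have hij : (r j : ℂ) * x j = r i * x i := (hall j).trans (hall i).symm
  have hik : (r k : ℂ) * x k = r i * x i := (hall k).trans (hall i).symm
  have hi' : r i = 1 := hi
  have hj' : r j = -1 := hj
  rw [hi'] at hij hik
  rw [hj'] at hij
  have hxi : (x i : ℂ) ≠ 0 := (x i).coe_ne_zero
  have hxj : (x j : ℂ) / x i = -1 := by
    field_simp
    push_cast at hij
    linear_combination -hij
  have hxk : (x k : ℂ) / x i = 1 ∨ (x k : ℂ) / x i = -1 := by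
    rcases hr1 k with h | h
    · left
      rw [h] at hik
      field_simp
      push_cast at hik
      linear_combination hik
    · right
      rw [h] at hik
      field_simp
      push_cast at hik
      linear_combination -hik
  have hrel : ((x j : ℂ) / x i) ^ p = ((x k : ℂ) / x i) ^ q := by
    have := congrArg (fun c : Circle => (c : ℂ)) (show (x j / x i) ^ p = (x k / x i) ^ q from hxK)
    simpa using this
  have hone : ((x k : ℂ) / x i) ^ q = 1 := by
    rcases hxk with h | h <;> rw [h]
    · exact one_zpow q
    · exact hq.neg_one_zpow
  rw [hxj, hone, hp.neg_one_zpow] at hrel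
  norm_num at hrel

/-- Fractions with odd numerator and even denominator are dense. -/
theorem exists_odd_div_even_between {x y : ℝ} (hxy : x < y) :
    ∃ p q : ℤ, Odd p ∧ Even q ∧ 0 < q ∧ x < (p : ℝ) / q ∧ (p : ℝ) / q < y := by
  obtain ⟨N, hN⟩ := exists_nat_gt (1 / (y - x))
  have hd : 0 < y - x := sub_pos.mpr hxy
  have hN0 : (0 : ℝ) < N := lt_trans (by positivity) hN
  have hN1 : 1 < N * (y - x) := by rwa [div_lt_iff₀ hd] at hN
  set f := ⌊(2 * N * x + 1) / 2⌋ with hf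
  have h1 : (f : ℝ) ≤ (2 * N * x + 1) / 2 := Int.floor_le _
  have h2 : (2 * N * x + 1) / 2 < f + 1 := Int.lt_floor_add_one _
  refine ⟨2 * f + 1, 2 * N, ⟨f, rfl⟩, even_two_mul _, ?_, ?_, ?_⟩
  · have : 0 < N := by exact_mod_cast hN0
    positivity
  · push_cast
    rw [lt_div_iff₀ (by positivity)]
    linarith
  · push_cast
    rw [div_lt_iff₀ (by positivity)]
    linarith

/-! ### Central moments -/

/-- The second and third central moments of the spectrum of the looped path are not, on any
interval, constant multiples of the square and the cube of one function. The left-hand sides are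
`n * M₂ - M₁ ^ 2` and `n ^ 2 * M₃ - 3 * n * M₁ * M₂ + 2 * M₁ ^ 3`, where `M₁`, `M₂`, `M₃` are the
power sums of the eigenvalues. -/
theorem not_central_moments_proportional {n a b c₂ c₃ : ℝ} (hn : 3 ≤ n) (hab : a < b)
    (h : ∀ w ∈ Set.Ioo a b, ∃ g : ℝ,
      n * (2 * w ^ 2 + 2 * (n - 1)) - (2 * w) ^ 2 = c₂ * g ^ 2 ∧
      n ^ 2 * (2 * w ^ 3 + 6 * w) - 3 * n * (2 * w) * (2 * w ^ 2 + 2 * (n - 1)) + 2 * (2 * w) ^ 3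
        = c₃ * g ^ 3) : False := by
  open Polynomial in
  let P₂ : ℝ[X] := C n * (2 * X ^ 2 + C (2 * (n - 1))) - (2 * X) ^ 2
  let P₃ : ℝ[X] := C (n ^ 2) * (2 * X ^ 3 + 6 * X)
    - C (3 * n) * (2 * X) * (2 * X ^ 2 + C (2 * (n - 1))) + 2 * (2 * X) ^ 3
  have e₂ (w : ℝ) : P₂.eval w = n * (2 * w ^ 2 + 2 * (n - 1)) - (2 * w) ^ 2 := by simp [P₂]
  have e₃ (w : ℝ) : P₃.eval w = n ^ 2 * (2 * w ^ 3 + 6 * w)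
      - 3 * n * (2 * w) * (2 * w ^ 2 + 2 * (n - 1)) + 2 * (2 * w) ^ 3 := by simp [P₃]
  have hinf : (Set.Ioo a b).Infinite := Set.Ioo_infinite hab
  have hid : C (c₂ ^ 3) * P₃ ^ 2 = C (c₃ ^ 2) * P₂ ^ 3 := by
    refine Polynomial.eq_of_infinite_eval_eq _ _ (hinf.mono fun w hw => ?_)
    obtain ⟨g, h₂, h₃⟩ := h w hw
    simp only [Set.mem_ofPred_eq, eval_mul, eval_C, eval_pow, e₂, e₃, h₂, h₃]
    ring
  have hc₃ : c₃ = 0 := by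
    have h0 := congrArg (Polynomial.eval 0) hid
    simp only [eval_mul, eval_C, eval_pow, e₂, e₃] at h0
    have hpos : 0 < (n * (2 * (n - 1))) ^ 3 := by
      have : 0 < n * (2 * (n - 1)) := by nlinarith
      positivity
    have h1 : c₃ ^ 2 * (n * (2 * (n - 1))) ^ 3 = 0 := by linear_combination -h0
    exact pow_eq_zero_iff two_ne_zero |>.mp ((mul_eq_zero.mp h1).resolve_right hpos.ne')
  have hP₃ : P₃ = 0 := by
    refine Polynomial.eq_of_infinite_eval_eq _ _ (hinf.mono fun w hw => ?_)
    obtain ⟨g, -, h₃⟩ := h w hw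
    simp [e₃, h₃, hc₃]
  -- At `w = 1` the third moment is `-4 * (n - 2) * (n + 2)`.
  have h1 := e₃ 1
  rw [hP₃, Polynomial.eval_zero] at h1
  nlinarith

/-! ### Eigenvectors of the looped path -/

namespace loopedPathMatrix

variable {n : ℕ}

theorem isHermitian (w : ℝ) : (loopedPathMatrix n w).IsHermitian := by
  ext i j
  simp only [Matrix.conjTranspose_apply, loopedPathMatrix, Matrix.of_apply, star_trivial]
  by_cases h : i = j
  · simp [h]
  · simp [h, Ne.symm h, or_comm]

theorem apply_rev_rev (w : ℝ) (i j : Fin n) :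
    loopedPathMatrix n w i.rev j.rev = loopedPathMatrix n w i j := by
  have hi := i.isLt
  have hj := j.isLt
  simp only [loopedPathMatrix, Matrix.of_apply, Fin.rev_inj, Fin.val_rev]
  congr 1
  · congr 1
    apply propext
    omega
  · congr 1
    apply propext
    omega

/-- Row `k` of the eigenvalue equation expresses coordinate `k + 1` of an eigenvector by the
previous ones, so an eigenvector whose first coordinate vanishes is zero. -/
theorem eq_zero_of_mulVec_eq_smul (hn : 0 < n) {w θ : ℝ} {v : Fin n → ℝ}
    (h : (loopedPathMatrix n w).mulVec v = θ • v) (h0 : v ⟨0, hn⟩ = 0) : v = 0 := by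
  have key (k : ℕ) : ∀ i : Fin n, i.val ≤ k → v i = 0 := by
    induction k with
    | zero =>
      intro i hi
      rwa [show i = ⟨0, hn⟩ from Fin.ext (by simpa using hi)]
    | succ k ih =>
      intro i hi
      rcases Nat.lt_or_ge k i.val with hlt | hge
      · have hik : i.val = k + 1 := by omega
        have hrow := congrFun h ⟨k, by omega⟩
        rw [Matrix.mulVec, dotProduct, Finset.sum_eq_single i] at hrow
        · simpa [loopedPathMatrix, Fin.ext_iff, hik, ih ⟨k, by omega⟩ le_rfl] using hrow
        · intro j _ hji
          have hji' : j.val ≠ i.val := fun hc => hji (Fin.ext hc)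
          rcases Nat.lt_or_ge k j.val with hj | hj
          · have h1 : ¬ k = j.val := by omega
            have h2 : ¬ (k + 1 = j.val ∨ j.val + 1 = k) := by omega
            simp [loopedPathMatrix, Fin.ext_iff, h1, h2]
          · rw [ih j hj, mul_zero]
        · simp
      · exact ih i hge
  exact funext fun i => key i.val i le_rfl

/-- Every eigenvector is even or odd under the reflection of the path. -/
theorem rev_mul_eq (hn : 0 < n) {w θ : ℝ} {v : Fin n → ℝ}
    (h : (loopedPathMatrix n w).mulVec v = θ • v) (a : Fin n) :
    v a.rev * v ⟨0, hn⟩ = v ⟨n - 1, by omega⟩ * v a := by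
  have hrev : (loopedPathMatrix n w).mulVec (fun a => v a.rev) = θ • (fun a => v a.rev) := by
    funext i
    have := congrFun h i.rev
    rw [Matrix.mulVec, dotProduct, ← Equiv.sum_comp Fin.revPerm] at this
    simpa [Matrix.mulVec, dotProduct, apply_rev_rev] using this
  have hlast : Fin.rev (⟨0, hn⟩ : Fin n) = ⟨n - 1, by omega⟩ := Fin.ext (by simp [Fin.val_rev])
  -- This combination of `v` and its reflection is an eigenvector that vanishes at the first vertex.
  have hz := eq_zero_of_mulVec_eq_smul hn
    (v := v ⟨0, hn⟩ • (fun a => v a.rev) - v ⟨n - 1, by omega⟩ • v) (θ := θ) (w := w)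
    (by rw [Matrix.mulVec_sub, Matrix.mulVec_smul, Matrix.mulVec_smul, hrev, h, smul_sub,
      smul_comm, smul_comm (v ⟨n - 1, by omega⟩)])
    (by simp [hlast, mul_comm])
  have := congrFun hz a
  simp only [Pi.sub_apply, Pi.smul_apply, smul_eq_mul, Pi.zero_apply] at this
  linarith

theorem mulVec_sub_apply (w w' : ℝ) (v : Fin n → ℝ) (a : Fin n) :
    (loopedPathMatrix n w' - loopedPathMatrix n w).mulVec v a
      = (w' - w) * (if a.val = 0 ∨ a.val + 1 = n then v a else 0) := by
  rw [Matrix.mulVec, dotProduct, Finset.sum_eq_single a]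
  · by_cases h : a.val = 0 ∨ a.val + 1 = n <;> simp [loopedPathMatrix, h]
  · intro b _ hb
    simp [loopedPathMatrix, Ne.symm hb]
  · simp

theorem sum_mulVec_sub_sq_le (w w' : ℝ) (v : Fin n → ℝ) :
    ∑ a, ((loopedPathMatrix n w' - loopedPathMatrix n w).mulVec v a) ^ 2
      ≤ |w' - w| ^ 2 * ∑ a, v a ^ 2 := by
  rw [sq_abs, Finset.mul_sum]
  refine Finset.sum_le_sum fun a _ => ?_
  rw [mulVec_sub_apply, mul_pow]
  refine mul_le_mul_of_nonneg_left ?_ (sq_nonneg _)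
  split_ifs
  · exact le_rfl
  · simpa using sq_nonneg (v a)

/-! ### Traces of powers -/

/-- Adjacency matrix of the path without loops. -/
noncomputable def path (n : ℕ) : Matrix (Fin n) (Fin n) ℝ := loopedPathMatrix n 0

/-- Diagonal indicator of the two ends of the path. -/
noncomputable def ends (n : ℕ) : Matrix (Fin n) (Fin n) ℝ :=
  Matrix.diagonal fun i => if i.val = 0 ∨ i.val + 1 = n then 1 else 0

theorem eq_smul_ends_add_path (w : ℝ) : loopedPathMatrix n w = w • ends n + path n := by
  ext i j
  by_cases h : i = j
  · subst h
    simp [loopedPathMatrix, ends, path]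
  · simp [loopedPathMatrix, ends, path, h]

theorem path_apply (i j : Fin n) :
    path n i j = (if i.val + 1 = j.val then 1 else 0) + if j.val + 1 = i.val then 1 else 0 := by
  by_cases h : i = j
  · simp [path, loopedPathMatrix, h]
  · by_cases h1 : i.val + 1 = j.val
    · have h2 : ¬ j.val + 1 = i.val := by omega
      simp [path, loopedPathMatrix, h, h1, h2]
    · simp [path, loopedPathMatrix, h, h1]

theorem sum_ite_ends (hn : 2 ≤ n) (f : Fin n → ℝ) :
    ∑ i : Fin n, (if i.val = 0 ∨ i.val + 1 = n then f i else 0)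
      = f ⟨0, by omega⟩ + f ⟨n - 1, by omega⟩ := by
  rw [← Finset.sum_filter, ← Finset.sum_pair (f := f) (by simp [Fin.ext_iff]; omega)]
  congr 1
  ext i
  simp [Fin.ext_iff]
  omega

/-- The degree of a vertex of the path is `2`, less one at each end. -/
theorem path_sq_diag (hn : 2 ≤ n) (i : Fin n) :
    (path n * path n) i i = 2 - if i.val = 0 ∨ i.val + 1 = n then 1 else 0 := by
  have hi := i.isLt
  have hterm (j : Fin n) : path n i j * path n j i
      = (if i.val + 1 = j.val then 1 else 0) + if j.val + 1 = i.val then 1 else 0 := by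
    rw [path_apply, path_apply]
    split_ifs <;> first | omega | norm_num
  have h1 : ∑ j : Fin n, (if i.val + 1 = j.val then (1 : ℝ) else 0)
      = if i.val + 1 = n then 0 else 1 := by
    split_ifs with h
    · exact Finset.sum_eq_zero fun j _ => if_neg (by have := j.isLt; omega)
    · rw [Finset.sum_eq_single ⟨i.val + 1, by omega⟩]
      · simp
      · intro j _ hj
        exact if_neg fun hc => hj (Fin.ext hc.symm)
      · simp
  have h2 : ∑ j : Fin n, (if j.val + 1 = i.val then (1 : ℝ) else 0)
      = if i.val = 0 then 0 else 1 := by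
    split_ifs with h
    · exact Finset.sum_eq_zero fun j _ => if_neg (by omega)
    · rw [Finset.sum_eq_single ⟨i.val - 1, by omega⟩]
      · exact if_pos (by simp; omega)
      · intro j _ hj
        exact if_neg fun hc => hj (Fin.ext (by simp; omega))
      · simp
  rw [Matrix.mul_apply, Finset.sum_congr rfl fun j _ => hterm j, Finset.sum_add_distrib, h1, h2]
  split_ifs <;> first | omega | norm_num

theorem trace_ends (hn : 2 ≤ n) : (ends n).trace = 2 := by
  rw [ends, Matrix.trace_diagonal, sum_ite_ends hn fun _ => 1]
  norm_num

theorem ends_mul_ends : ends n * ends n = ends n := by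
  rw [ends, Matrix.diagonal_mul_diagonal]
  simp

theorem path_diag (i : Fin n) : path n i i = 0 := by simp [path_apply]

theorem trace_ends_mul (M : Matrix (Fin n) (Fin n) ℝ) :
    (ends n * M).trace = ∑ i : Fin n, if i.val = 0 ∨ i.val + 1 = n then M i i else 0 := by
  simp [ends, Matrix.trace, Matrix.diagonal_mul]

theorem trace_ends_mul_path : (ends n * path n).trace = 0 := by
  simp [trace_ends_mul, path_diag]

theorem trace_path : (path n).trace = 0 := by simp [Matrix.trace, path_diag]

theorem trace_path_sq (hn : 2 ≤ n) : (path n * path n).trace = 2 * (n - 1) := by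
  simp only [Matrix.trace, Matrix.diag_apply, path_sq_diag hn, Finset.sum_sub_distrib,
    sum_ite_ends hn fun _ => (1 : ℝ)]
  simp
  ring

theorem trace_ends_mul_path_sq (hn : 2 ≤ n) : (ends n * (path n * path n)).trace = 2 := by
  rw [trace_ends_mul, sum_ite_ends hn, path_sq_diag hn, path_sq_diag hn, if_pos (by simp),
    if_pos (by right; simp; omega)]
  norm_num

/-- The path is bipartite, so it has no closed walks of length three. -/
theorem trace_path_cube : (path n * (path n * path n)).trace = 0 := by
  rw [Matrix.trace]
  refine Finset.sum_eq_zero fun i _ => ?_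
  rw [Matrix.diag_apply, Matrix.mul_apply]
  refine Finset.sum_eq_zero fun j _ => ?_
  rw [Matrix.mul_apply, Finset.mul_sum]
  refine Finset.sum_eq_zero fun k _ => ?_
  simp only [path_apply]
  split_ifs <;> first | omega | norm_num

theorem trace_pow_one (hn : 2 ≤ n) (w : ℝ) : (loopedPathMatrix n w ^ 1).trace = 2 * w := by
  rw [pow_one, eq_smul_ends_add_path, Matrix.trace_add, Matrix.trace_smul, trace_ends hn,
    trace_path, smul_eq_mul]
  ring

theorem trace_pow_two (hn : 2 ≤ n) (w : ℝ) :
    (loopedPathMatrix n w ^ 2).trace = 2 * w ^ 2 + 2 * (n - 1) := by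
  rw [pow_two, eq_smul_ends_add_path]
  simp only [Matrix.add_mul, Matrix.mul_add, Matrix.smul_mul, Matrix.mul_smul, Matrix.trace_add,
    Matrix.trace_smul, smul_eq_mul, ends_mul_ends, Matrix.trace_mul_comm (path n) (ends n),
    trace_ends hn, trace_ends_mul_path, trace_path_sq hn]
  ring

theorem trace_pow_three (hn : 2 ≤ n) (w : ℝ) :
    (loopedPathMatrix n w ^ 3).trace = 2 * w ^ 3 + 6 * w := by
  have h1 : (path n * (ends n * path n)).trace = 2 := by
    rw [Matrix.trace_mul_comm, Matrix.mul_assoc, trace_ends_mul_path_sq hn]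
  have h2 : (path n * (path n * ends n)).trace = 2 := by
    rw [← Matrix.mul_assoc, Matrix.trace_mul_comm, trace_ends_mul_path_sq hn]
  have h3 : (ends n * (path n * ends n)).trace = 0 := by
    rw [Matrix.trace_mul_comm, Matrix.mul_assoc, ends_mul_ends, Matrix.trace_mul_comm,
      trace_ends_mul_path]
  have h4 : (ends n * (ends n * path n)).trace = 0 := by
    rw [← Matrix.mul_assoc, ends_mul_ends, trace_ends_mul_path]
  have h5 : (path n * ends n).trace = 0 := by rw [Matrix.trace_mul_comm, trace_ends_mul_path]
  rw [pow_succ', pow_two, eq_smul_ends_add_path]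
  simp only [Matrix.add_mul, Matrix.mul_add, Matrix.smul_mul, Matrix.mul_smul, Matrix.trace_add,
    Matrix.trace_smul, smul_eq_mul, ends_mul_ends, trace_ends hn, h1, h2, h3, h4, h5,
    trace_ends_mul_path_sq hn, trace_path_cube, smul_add]
  ring

/-! ### Eigenvalue curves -/

/-- A chosen orthogonal diagonalisation of the looped path. -/
noncomputable def eigensystem (hn : 0 < n) (w : ℝ) : StrictEigensystem (loopedPathMatrix n w) :=
  ((isHermitian w).nonempty_strictEigensystem ⟨0, hn⟩
    fun _ _ h h0 => eq_zero_of_mulVec_eq_smul hn h h0).some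

/-- The sign `±1` by which the reflection of the path acts on the `l`-th eigenvector. -/
noncomputable def mirrorSign (hn : 0 < n) (w : ℝ) (l : Fin n) : ℝ :=
  (eigensystem hn w).vec ⟨n - 1, by omega⟩ l / (eigensystem hn w).vec ⟨0, hn⟩ l

theorem vec_zero_ne_zero (hn : 0 < n) (w : ℝ) (l : Fin n) :
    (eigensystem hn w).vec ⟨0, hn⟩ l ≠ 0 := by
  intro h0
  have hz := eq_zero_of_mulVec_eq_smul hn ((eigensystem hn w).mulVec_col l) h0
  have h1 := (eigensystem hn w).sum_col_mul_col l l
  rw [Finset.sum_eq_zero fun a _ => by simp [congrFun hz a]] at h1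
  simp at h1

theorem vec_rev (hn : 0 < n) (w : ℝ) (l a : Fin n) :
    (eigensystem hn w).vec a.rev l = mirrorSign hn w l * (eigensystem hn w).vec a l := by
  have h := rev_mul_eq hn ((eigensystem hn w).mulVec_col l) a
  have h0 := vec_zero_ne_zero hn w l
  rw [mirrorSign]
  field_simp
  linarith

theorem mirrorSign_sq (hn : 0 < n) (w : ℝ) (l : Fin n) : mirrorSign hn w l ^ 2 = 1 := by
  have h := vec_rev hn w l (Fin.rev ⟨0, hn⟩)
  rw [Fin.rev_rev, vec_rev] at h
  have h0 := vec_zero_ne_zero hn w l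
  refine mul_right_cancel₀ h0 ?_
  linarith

/-- Near `w₀` the `l`-th eigenvalue is within `|w - w₀|` of its value at `w₀`, and the parity of its
eigenvector is unchanged. -/
theorem eventually_near (hn : 0 < n) (w₀ : ℝ) : ∀ᶠ w in nhds w₀, ∀ l,
    |(eigensystem hn w).val l - (eigensystem hn w₀).val l| ≤ |w - w₀| ∧
      mirrorSign hn w l = mirrorSign hn w₀ l := by
  have hgap : ∀ᶠ w in nhds w₀, ∀ l m, l < m →
      (eigensystem hn w₀).val l + 2 * |w - w₀| < (eigensystem hn w₀).val m := by
    simp only [Filter.eventually_all]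
    intro l m hlm
    have hc : Continuous fun w : ℝ => (eigensystem hn w₀).val l + 2 * |w - w₀| := by fun_prop
    exact hc.continuousAt.eventually_lt continuousAt_const
      (by simpa using (eigensystem hn w₀).strictMono_val hlm)
  filter_upwards [hgap] with w hw l
  obtain ⟨h1, h2⟩ := (eigensystem hn w₀).val_near (eigensystem hn w) (abs_nonneg _)
    (sum_mulVec_sub_sq_le w₀ w) hw l
  refine ⟨h1, ?_⟩
  set S := ∑ a, (eigensystem hn w₀).vec a l * (eigensystem hn w).vec a l with hS
  -- Eigenvectors of opposite parity would be orthogonal.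
  have hSS : S = mirrorSign hn w₀ l * mirrorSign hn w l * S := by
    conv_lhs => rw [hS, ← Equiv.sum_comp Fin.revPerm]
    simp only [Fin.revPerm_apply, vec_rev]
    rw [hS, Finset.mul_sum]
    exact Finset.sum_congr rfl fun a _ => by ring
  have hprod : mirrorSign hn w₀ l * mirrorSign hn w l = 1 := mul_right_cancel₀ h2 (by linarith)
  have hsq := mirrorSign_sq hn w₀ l
  linear_combination mirrorSign hn w₀ l * hprod - mirrorSign hn w l * hsq

theorem continuous_val (hn : 0 < n) (l : Fin n) :
    Continuous fun w => (eigensystem hn w).val l := by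
  rw [continuous_iff_continuousAt]
  intro w₀
  rw [ContinuousAt, tendsto_iff_dist_tendsto_zero]
  refine squeeze_zero' (Filter.Eventually.of_forall fun _ => dist_nonneg)
    ((eventually_near hn w₀).mono fun w hw => (hw l).1) ?_
  have hc : Continuous fun w : ℝ => |w - w₀| := by fun_prop
  simpa using hc.tendsto w₀

theorem mirrorSign_eq (hn : 0 < n) (w w' : ℝ) (l : Fin n) :
    mirrorSign hn w l = mirrorSign hn w' l := by
  have h : IsLocallyConstant fun w => mirrorSign hn w l :=
    (IsLocallyConstant.iff_eventually_eq _).mpr fun w₀ =>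
      (eventually_near hn w₀).mono fun w hw => (hw l).2
  exact h.apply_eq_of_preconnectedSpace w w'

/-- Both parities occur: otherwise the first and the last row of the orthogonal matrix of
eigenvectors would agree up to sign. -/
theorem exists_mirrorSign_eq (hn : 2 ≤ n) (w : ℝ) {s : ℝ} (hs : s ^ 2 = 1) :
    ∃ l, mirrorSign (zero_lt_two.trans_le hn) w l = s := by
  have hn0 : 0 < n := by omega
  by_contra! h
  have hneg (l : Fin n) : mirrorSign hn0 w l = -s :=
    (sq_eq_sq_iff_eq_or_eq_neg.mp ((mirrorSign_sq hn0 w l).trans hs.symm)).resolve_left (h l)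
  have h0 := (eigensystem hn0 w).sum_row_mul_row ⟨n - 1, by omega⟩ ⟨0, hn0⟩
  have h1 := (eigensystem hn0 w).sum_row_mul_row ⟨0, hn0⟩ ⟨0, hn0⟩
  rw [if_neg (by simp [Fin.ext_iff]; omega)] at h0
  rw [if_pos rfl] at h1
  have hrow (l : Fin n) : (eigensystem hn0 w).vec ⟨n - 1, by omega⟩ l
      = -s * (eigensystem hn0 w).vec ⟨0, hn0⟩ l := by
    rw [← hneg l, mirrorSign, div_mul_cancel₀ _ (vec_zero_ne_zero hn0 w l)]
  simp only [hrow, mul_assoc, ← Finset.mul_sum, h1] at h0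
  have : s = 0 := by linarith
  simp [this] at hs

/-! ### Intervals of state transfer -/

/-- On an interval where pretty good state transfer always occurs, every ratio of eigenvalue gaps
based at two eigenvalues of opposite parity is constant, since it omits a dense set of rationals. -/
theorem ratio_const_of_hasPGST (hn : 2 ≤ n) (hn0 : 0 < n) (hn1 : n - 1 < n) {a b : ℝ}
    (h : ∀ w ∈ Set.Ioo a b, HasPGST (loopedPathMatrix n w) ⟨0, hn0⟩ ⟨n - 1, hn1⟩) :
    ∃ i j : Fin n, i ≠ j ∧ ∀ k, ∀ w ∈ Set.Ioo a b, ∀ w' ∈ Set.Ioo a b,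
      ((eigensystem hn0 w).val k - (eigensystem hn0 w).val i)
          / ((eigensystem hn0 w).val j - (eigensystem hn0 w).val i)
        = ((eigensystem hn0 w').val k - (eigensystem hn0 w').val i)
          / ((eigensystem hn0 w').val j - (eigensystem hn0 w').val i) := by
  obtain ⟨i, hi⟩ := exists_mirrorSign_eq hn 0 (one_pow 2)
  obtain ⟨j, hj⟩ := exists_mirrorSign_eq hn 0 (s := -1) (by norm_num)
  have hij : i ≠ j := by
    rintro rfl
    rw [hi] at hj
    norm_num at hj
  refine ⟨i, j, hij, fun k => ?_⟩
  set θ : Fin n → ℝ → ℝ := fun l w => (eigensystem hn0 w).val l with hθ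
  have hne (w : ℝ) : θ j w - θ i w ≠ 0 :=
    sub_ne_zero.mpr fun hc => hij ((eigensystem hn0 w).strictMono_val.injective hc).symm
  set f : ℝ → ℝ := fun w => (θ k w - θ i w) / (θ j w - θ i w) with hf
  have hcont : Continuous f :=
    ((continuous_val hn0 k).sub (continuous_val hn0 i)).div
      ((continuous_val hn0 j).sub (continuous_val hn0 i)) hne
  have hcon : (f '' Set.Ioo a b).OrdConnected :=
    (isPreconnected_Ioo.image f hcont.continuousOn).ordConnected
  have hle : ∀ w ∈ Set.Ioo a b, ∀ w' ∈ Set.Ioo a b, ¬ f w < f w' := by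
    intro w hw w' hw' hlt
    obtain ⟨p, q, hp, hq, hq0, h1, h2⟩ := exists_odd_div_even_between hlt
    obtain ⟨x, hx, hxf⟩ := hcon.out (Set.mem_image_of_mem f hw) (Set.mem_image_of_mem f hw')
      ⟨h1.le, h2.le⟩
    refine (eigensystem hn0 x).not_hasPGST (vec_zero_ne_zero hn0 x) (mirrorSign_sq hn0 x) k
      ((mirrorSign_eq hn0 x 0 i).trans hi) ((mirrorSign_eq hn0 x 0 j).trans hj) hp hq ?_ (h x hx)
    have hqr : (q : ℝ) ≠ 0 := by exact_mod_cast hq0.ne'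
    have hnex := hne x
    have hxf' : (θ k x - θ i x) / (θ j x - θ i x) = p / q := hxf
    rw [div_eq_div_iff hnex hqr] at hxf'
    simp only [hθ] at hxf'
    linear_combination -hxf'
  intro w hw w' hw'
  exact le_antisymm (not_lt.mp (hle w' hw' w hw)) (not_lt.mp (hle w hw w' hw'))

theorem exists_mem_Ioo_not_hasPGST (hn : 3 ≤ n) (hn0 : 0 < n) (hn1 : n - 1 < n) {a b : ℝ}
    (hab : a < b) : ∃ w ∈ Set.Ioo a b, ¬ HasPGST (loopedPathMatrix n w) ⟨0, hn0⟩ ⟨n - 1, hn1⟩ := by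
  by_contra! h
  have hn2 : 2 ≤ n := by omega
  obtain ⟨i, j, hij, hconst⟩ := ratio_const_of_hasPGST hn2 hn0 hn1 h
  obtain ⟨w₀, hw₀⟩ := Set.nonempty_Ioo.mpr hab
  set r : Fin n → ℝ := fun k => ((eigensystem hn0 w₀).val k - (eigensystem hn0 w₀).val i)
    / ((eigensystem hn0 w₀).val j - (eigensystem hn0 w₀).val i) with hr
  refine not_central_moments_proportional (n := n) (by exact_mod_cast hn) hab
    (c₂ := n * ∑ k, r k ^ 2 - (∑ k, r k) ^ 2)
    (c₃ := n ^ 2 * ∑ k, r k ^ 3 - 3 * n * (∑ k, r k) * (∑ k, r k ^ 2) + 2 * (∑ k, r k) ^ 3)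
    fun w hw => ?_
  set E := eigensystem hn0 w with hE
  set α := E.val i with hα
  set g := E.val j - E.val i with hg
  have hg0 : g ≠ 0 := sub_ne_zero.mpr fun hc => hij (E.strictMono_val.injective hc).symm
  have hval (k : Fin n) : E.val k = α + r k * g := by
    have h1 : (E.val k - α) / g = r k := hconst k w hw w₀ hw₀
    rw [← h1, div_mul_cancel₀ _ hg0]
    ring
  have s₁ : 2 * w = n * α + (∑ k, r k) * g := by
    rw [← trace_pow_one hn2 w, E.trace_pow]
    simp only [hval, pow_one, Finset.sum_add_distrib, Finset.sum_mul]
    simp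
  have s₂ : 2 * w ^ 2 + 2 * ((n : ℝ) - 1)
      = n * α ^ 2 + 2 * α * g * (∑ k, r k) + g ^ 2 * ∑ k, r k ^ 2 := by
    have hterm (k : Fin n) :
        E.val k ^ 2 = α ^ 2 + 2 * α * g * r k + g ^ 2 * r k ^ 2 := by rw [hval]; ring
    rw [← trace_pow_two hn2 w, E.trace_pow]
    simp only [hterm, Finset.sum_add_distrib, ← Finset.mul_sum]
    simp
  have s₃ : 2 * w ^ 3 + 6 * w = n * α ^ 3 + 3 * α ^ 2 * g * (∑ k, r k)
      + 3 * α * g ^ 2 * (∑ k, r k ^ 2) + g ^ 3 * ∑ k, r k ^ 3 := by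
    have hterm (k : Fin n) : E.val k ^ 3
        = α ^ 3 + 3 * α ^ 2 * g * r k + 3 * α * g ^ 2 * r k ^ 2 + g ^ 3 * r k ^ 3 := by
      rw [hval]; ring
    rw [← trace_pow_three hn2 w, E.trace_pow]
    simp only [hterm, Finset.sum_add_distrib, ← Finset.mul_sum]
    simp
  refine ⟨g, ?_, ?_⟩
  · rw [s₁, s₂]; ring
  · rw [s₁, s₂, s₃]; ring

end loopedPathMatrix

theorem mainTheorem1 (n : ℕ) (hn : 3 ≤ n) :
    Dense {w : Set.Ici (1 : ℝ) |
      ¬ HasPGST (loopedPathMatrix n (w : ℝ)) (⟨0, by omega⟩ : Fin n) (⟨n - 1, by omega⟩ : Fin n)} := by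
  rw [Metric.dense_iff]
  intro x ε hε
  obtain ⟨w, hw, h⟩ := loopedPathMatrix.exists_mem_Ioo_not_hasPGST hn _ _
    (show (x : ℝ) < x + ε by linarith)
  have hx : (1 : ℝ) ≤ x := x.2
  refine ⟨⟨w, hx.trans hw.1.le⟩, ?_, h⟩
  rw [Metric.mem_ball, Subtype.dist_eq, Real.dist_eq, abs_lt]
  constructor <;> linarith [hw.1, hw.2]
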